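/- Let $k$ be a field and let $G$ be a smooth geometrically connected group scheme over $k$, with multiplication $\mu\colon G\times_k G\to G$ and unit $e\in G(k)$. Let $A$ be a finite group and let $f\colon H\to G$ be an $A$-torsor (that is, $f$ is a finite étale surjective morphism of $k$-schemes with an action of $A$ on $H$ over $G$ such that $A\times H\to H\times_G H$, $(a,h)\mapsto (ah,h)$, is an isomorphism). Assume that $H$ is geometrically connected over $k$ and that $f^{-1}(e)=H\times_G e$ has a $k$-rational point. Let $\xi\colon \operatorname{Spec}K\to G$ and $\eta\colon\operatorname{Spec}L\to H$ be the generic points, where $K$ and $L$ are the residue fields, so that $f$ induces a field extension $K\to L$. Let $L'$ be any extension field of $L$ and let $\eta'\colon \operatorname{Spec}L'\to H$ be the composition of $\operatorname{Spec}L'\to\operatorname{Spec}L$ with $\eta$. Let $\mu_K\colon G_K\to G_K$, $G_K=G\times_k\operatorname{Spec}K$, be the translation by $\xi$, i.e. the $K$-morphism induced by $\mu\circ(1_G\times\xi)\colon G\times_k\operatorname{Spec}K\to G\times_k G\to G$. Similarly, for a $k$-morphism $\nu\colon H\times_k H\to H$, let $\nu_{L'}\colon H_{L'}\to H_{L'}$,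 $H_{L'}=H\times_k\operatorname{Spec}L'$, be the $L'$-morphism induced by $\nu\circ(1_H\times\eta')\colon H\times_k\operatorname{Spec}L'\to H\times_k H\to H$. Let $M$ be the set of group structures $\nu\colon H\times_k H\to H$ of schemes over $k$ such that $f\colon H\to G$ is a morphism of group schemes, and let $M'$ be the set of isomorphisms $\nu'\colon H_{L'}\to H_{L'}$ of schemes over $L'$ such that $$p\circ\nu'=\mu_K\circ p,$$ where $p\colon H_{L'}\to G_K$ is the morphism induced by $f$ and $\operatorname{Spec}L'\to\operatorname{Spec}K$. Then $\nu\mapsto\nu_{L'}$ maps $M$ into $M'$, and the map $$M\to M',\qquad \nu\mapsto\nu_{L'},$$ is a bijection. -/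

import Mathlib

open CategoryTheory Limits MonoidalCategory CartesianMonoidalCategory MonObj AlgebraicGeometry

universe u v

namespace EtaleIsogeny

noncomputable section

/-- Let a finite group `A` act on a `Y`-scheme `f : X ⟶ Y` by automorphisms over `Y`. Then `f` is
an `A`-torsor over `Y` if `f` is finite étale and surjective and
`A × X = ∐ₐ X ⟶ X ×[Y] X`, `(a, x) ↦ (a x, x)`, is an isomorphism. -/
structure IsTorsor {X Y : Scheme.{u}} (f : X ⟶ Y) {A : Type v} [Group A] [Finite A]
    (ρ : A →* Aut (Over.mk f)) : Prop where
  finite : IsFinite f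
  etale : Etale f
  surjective : Surjective f
  isIso_shear : IsIso (Sigma.desc (fun a : A =>
    pullback.lift (f := f) (g := f) (ρ a).hom.left (𝟙 X)
      ((Over.w (ρ a).hom).trans (Category.id_comp f).symm)))

section Points

variable {S : Scheme.{u}}

/-- `Spec κ(x)` as an `S`-scheme, for a point `x` of an `S`-scheme `X`. -/
abbrev residuePoint (X : Over S) (x : X.left) : Over S :=
  Over.mk (X.left.fromSpecResidueField x ≫ X.hom)

/-- The canonical `S`-morphism `Spec κ(x) ⟶ X`. -/
def residuePointMap (X : Over S) (x : X.left) : residuePoint X x ⟶ X :=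
  Over.homMk (X.left.fromSpecResidueField x)

/-- `Spec L'` as an `S`-scheme, for an extension field `L'` of the residue field `κ(x)`. -/
abbrev extensionPoint (X : Over S) (x : X.left) (L' : Type u) [Field L']
    [Algebra (X.left.residueField x) L'] : Over S :=
  Over.mk (Spec.map (CommRingCat.ofHom (algebraMap (X.left.residueField x) L')) ≫
    (residuePoint X x).hom)

/-- The `S`-morphism `Spec L' ⟶ Spec κ(x)` given by the field extension `L'` of `κ(x)`. -/
def extensionPointMap (X : Over S) (x : X.left) (L' : Type u) [Field L']
    [Algebra (X.left.residueField x) L'] : extensionPoint X x L' ⟶ residuePoint X x :=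
  Over.homMk (Spec.map (CommRingCat.ofHom (algebraMap (X.left.residueField x) L')))

/-- For an `S`-morphism `f : X ⟶ Y` sending `x` to `y`, the `S`-morphism
`Spec κ(x) ⟶ Spec κ(y)` given by the induced field extension `κ(y) ⟶ κ(x)`. -/
def residuePointHom {X Y : Over S} (f : X ⟶ Y) {x : X.left} {y : Y.left} (h : f.left x = y) :
    residuePoint X x ⟶ residuePoint Y y :=
  Over.homMk (Spec.map ((Y.left.residueFieldCongr h.symm).hom ≫ f.left.residueFieldMap x)) (by
    subst h
    simp [residuePoint])

end Points

/-- A surjective morphism sends a generic point to the generic point. -/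
theorem map_genericPoint {X Y : Scheme.{u}} (f : X ⟶ Y) (hf : Surjective f) {x : X} {y : Y}
    (hx : IsGenericPoint x Set.univ) (hy : IsGenericPoint y Set.univ) : f x = y := by
  have h := hx.image f.continuous
  rw [Set.image_univ, hf.surj.range_eq, closure_univ] at h
  exact h.eq hy

section Translation

variable {C : Type*} [Category C] [CartesianMonoidalCategory C]

/-- For a binary operation `m` on `X` and a `T`-valued point `x` of `X`, the morphism
`X × T ⟶ X × T`, `(y, t) ↦ (m (y, x t), t)`, that is, the translation `· x` of the base change
of `X` to `T`. -/
def translation {X T : C} (m : X ⊗ X ⟶ X) (x : T ⟶ X) : X ⊗ T ⟶ X ⊗ T :=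
  lift ((X ◁ x) ≫ m) (snd X T)

/-- The set of morphisms `ν : H × H ⟶ H` that are the multiplication of a group structure on `H`
for which `f : H ⟶ G` is a homomorphism. -/
def groupStructures {H G : C} [GrpObj G] (f : H ⟶ G) : Set (H ⊗ H ⟶ H) :=
  {ν | ∃ g : GrpObj H, g.mul = ν ∧ IsMonHom f}

/-- Let `x : T ⟶ G` be a `T`-valued point of a group object `G`, let `f : H ⟶ G` and `q : T' ⟶ T`.
The set of automorphisms of `H × T'` over `T'` that lift the translation of `G × T` by the given
point along `f × q : H × T' ⟶ G × T`. -/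
def translationLifts {H G T T' : C} [GrpObj G] (f : H ⟶ G) (x : T ⟶ G) (q : T' ⟶ T) :
    Set (H ⊗ T' ⟶ H ⊗ T') :=
  {ν' | IsIso ν' ∧ ν' ≫ snd H T' = snd H T' ∧
    ν' ≫ (f ⊗ₘ q) = (f ⊗ₘ q) ≫ translation μ[G] x}

end Translation

end

end EtaleIsogeny

/-! Everything rests on rigidity (`FormallyUnramified.eq_of_comp_eq`): as `f` is separated and
étale, two lifts along `f` of a map from a connected scheme coincide once they coincide on a
nonempty scheme. A multiplication in `M` lifts `μ ∘ (f × f)` on the connected `H × H`, so its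
restriction to `H × Spec L'` determines it; this is injectivity.

For surjectivity, let `ν'` be in `M'`. Its first component lifts `μ ∘ (f × f)` over `H × Spec L'`.
The first component of `ν'⁻¹(η')` lies over the unit of `G`, by cancellation in `G(L')`; since `f`
is a torsor with a rational point over the unit, it comes from a `k`-point `e` of `H`. At `e` the
lift takes the value `η`, which is defined over `L`, so by rigidity on the geometrically connected
`H` the lift descends to `L` (`exists_whiskerLeft_comp_eq`). It is now a section, over the generic
fibre of the second projection `H × H ⟶ H`, of the finite étale cover pulled back from `f`. This
cover is smooth over `k`, hence locally irreducible, so the closure of the section is open and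
closed and maps isomorphically to `H × H` (`exists_section_of_finite_of_etale_of_generic`). The
extended lift is a group law: units and associativity follow from `G` by rigidity, and inverses
exist because the shear map is finite étale and a monomorphism over the generic point
(`mem_groupStructures`). -/

section LocallyIrreducible

/-! ### Local irreducibility of smooth schemes -/

open TensorProduct in
/-- An idempotent of the base change of an étale algebra over a normal domain to the fraction field
is defined over the algebra. -/
theorem TensorProduct.exists_tmul_one_eq_of_isIdempotentElem {R S : Type*} [CommRing R] [IsDomain R]
    [IsIntegrallyClosed R] [CommRing S] [Algebra R S] [Algebra.Smooth R S]
    (e : S ⊗[R] FractionRing R) (he : IsIdempotentElem e) :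
    ∃ s : S, s ⊗ₜ[R] (1 : FractionRing R) = e := by
  have hi : IsIntegral S e :=
    ⟨Polynomial.X ^ 2 - Polynomial.X, by monicity!, by
      simp [sq, he.eq]⟩
  -- Integral closure commutes with smooth base change, and `R` is integrally closed in its fraction
  -- field.
  obtain ⟨x, hx⟩ := (TensorProduct.toIntegralClosure_bijective_of_smooth
    (R := R) (S := S) (B := FractionRing R)).2 ⟨e, hi⟩
  have hx' : Algebra.TensorProduct.map (.id S S) (integralClosure R (FractionRing R)).val x = e :=
    congr_arg Subtype.val hx
  clear hx
  subst hx'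
  clear he hi
  induction x with
  | zero => exact ⟨0, by simp⟩
  | add x y hx hy =>
    obtain ⟨a, ha⟩ := hx
    obtain ⟨b, hb⟩ := hy
    exact ⟨a + b, by rw [TensorProduct.add_tmul, ha, hb, map_add]⟩
  | tmul s y =>
    obtain ⟨r, hr⟩ := IsIntegrallyClosed.isIntegral_iff.mp y.2
    refine ⟨r • s, ?_⟩
    simp [← hr, Algebra.algebraMap_eq_smul_one, TensorProduct.smul_tmul']

open TensorProduct in
/-- The spectrum of an étale algebra over a normal domain is locally irreducible. -/
theorem PrimeSpectrum.exists_eventually_specializes_of_etale (R : Type*) {S : Type*} [CommRing R]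
    [IsDomain R] [IsIntegrallyClosed R] [CommRing S] [Algebra R S] [Algebra.Etale R S]
    (p : PrimeSpectrum S) : ∃ w : PrimeSpectrum S, ∀ᶠ z in nhds p, w ⤳ z := by
  let K := FractionRing R
  let E := S ⊗[R] K
  have hinj : Function.Injective (algebraMap S E) := by
    have := Module.Flat.lTensor_preserves_injective_linearMap (M := S)
      (Algebra.linearMap R K) (IsFractionRing.injective R K)
    have h := this.comp (TensorProduct.rid R S).symm.injective
    convert! h using 1
    ext a
    have h1 : algebraMap S E a = a ⊗ₜ 1 := rfl
    simp [h1]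
  have : IsArtinianRing E := by
    have := Algebra.FormallyUnramified.finite_of_free K (K ⊗[R] S)
    have : IsArtinianRing (K ⊗[R] S) := .of_finite K _
    exact (Algebra.TensorProduct.comm R K S).toRingEquiv.surjective.isArtinianRing
  have key (q : PrimeSpectrum E) : ∃ s : S,
      (PrimeSpectrum.basicOpen (algebraMap S E s) : Set (PrimeSpectrum E)) = {q} ∧
      IsIdempotentElem (algebraMap S E s) := by
    obtain ⟨e, he, h⟩ := PrimeSpectrum.exists_idempotent_basicOpen_eq_of_isClopen
      (isClopen_discrete {q})
    obtain ⟨s, hs⟩ := TensorProduct.exists_tmul_one_eq_of_isIdempotentElem e he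
    exact ⟨s, by rw [h, ← hs]; rfl, by rwa [← hs] at he⟩
  choose s hs hidem using key
  have := Fintype.ofFinite (PrimeSpectrum E)
  have exists_notMem {t : S} (ht : ¬ IsNilpotent t) :
      ∃ q : PrimeSpectrum E, algebraMap S E t ∉ q.asIdeal := by
    rw [← IsNilpotent.map_iff hinj, nilpotent_iff_mem_prime] at ht
    push Not at ht
    obtain ⟨J, hJ, h⟩ := ht
    exact ⟨⟨J, hJ⟩, h⟩
  have hmem (q : PrimeSpectrum E) (q' : PrimeSpectrum E) :
      algebraMap S E (s q) ∉ q'.asIdeal ↔ q' = q := by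
    simpa using Set.ext_iff.mp (hs q) q'
  -- The product of all `1 - s q` vanishes at every point of `Spec E`, so it is nilpotent in `S` and
  -- some factor lies in `p`.
  obtain ⟨q, hq⟩ : ∃ q, s q ∉ p.asIdeal := by
    by_contra! h
    have hone (q : PrimeSpectrum E) : 1 - s q ∉ p.asIdeal := fun h' ↦
      p.2.ne_top ((Ideal.eq_top_iff_one _).mpr (by simpa using add_mem h' (h q)))
    obtain ⟨q, hq⟩ := exists_notMem (t := ∏ q, (1 - s q)) fun hn ↦ by
      have := nilpotent_iff_mem_prime.mp hn _ p.2
      rw [p.2.prod_mem_iff] at this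
      obtain ⟨q, -, hq⟩ := this
      exact hone q hq
    refine hq ?_
    rw [map_prod]
    refine Ideal.mem_of_dvd _ (Finset.dvd_prod_of_mem _ (Finset.mem_univ q)) ?_
    refine (q.2.mem_or_mem (?_ : algebraMap S E (s q) * algebraMap S E (1 - s q) ∈ q.asIdeal)
      ).resolve_left ((hmem q q).mpr rfl)
    rw [map_sub, map_one, mul_sub, _root_.mul_one, (hidem q).eq, sub_self]
    exact zero_mem _
  refine ⟨PrimeSpectrum.comap (algebraMap S E) q, ?_⟩
  filter_upwards [(PrimeSpectrum.basicOpen (s q)).isOpen.mem_nhds hq] with z hz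
  rw [← PrimeSpectrum.le_iff_specializes]
  intro a ha
  by_contra haz
  have hnil : ¬ IsNilpotent (a * s q) := fun h ↦
    (z.2.mul_notMem haz hz) (nilpotent_iff_mem_prime.mp h _ z.2)
  obtain ⟨q', hq'⟩ := exists_notMem hnil
  rw [map_mul] at hq'
  have : q' = q := (hmem q q').mp fun h ↦ hq' (Ideal.mul_mem_left _ _ h)
  subst this
  exact hq' (Ideal.mul_mem_right _ _ ha)

/-- A smooth scheme over a field is locally irreducible. -/
theorem AlgebraicGeometry.Smooth.exists_eventually_specializes {k : Type u} [Field k] {P : Scheme.{u}}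
    (f : P ⟶ Spec (.of k)) [Smooth f] (p : P) : ∃ w : P, ∀ᶠ z in nhds p, w ⤳ z := by
  obtain ⟨_, ⟨V, hV, rfl⟩, hpV, -⟩ := P.isBasis_affineOpens.exists_subset_of_mem_open
    (Set.mem_univ p) isOpen_univ
  have hV : IsAffineOpen V := hV
  obtain ⟨ψ, hψ⟩ := Spec.map_surjective (hV.fromSpec ≫ f)
  let φ : k →+* Γ(P, V) := ψ.hom
  have hφ : φ.Smooth :=
    (HasRingHomProperty.Spec_iff (P := @Smooth)).mp (hψ ▸ inferInstance : Smooth (Spec.map ψ))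
  algebraize [φ]
  obtain ⟨q, hq⟩ : ∃ q, hV.fromSpec q = p := by
    have : p ∈ Set.range hV.fromSpec := by rw [hV.range_fromSpec]; exact hpV
    exact this
  have := q.2
  -- Locally the scheme is étale over an affine space, whose coordinate ring is a normal domain.
  obtain ⟨g, hg, n, _, _, _⟩ := Algebra.IsSmoothAt.exists_isStandardEtale_mvPolynomial
    (R := k) (S := Γ(P, V)) (p := q.asIdeal)
  let j := PrimeSpectrum.comap (algebraMap Γ(P, V) (Localization.Away g))
  have hj : Topology.IsOpenEmbedding j := PrimeSpectrum.localization_away_isOpenEmbedding _ g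
  obtain ⟨r, hr⟩ : ∃ r, j r = q := by
    have : q ∈ Set.range j := by
      rw [PrimeSpectrum.localization_away_comap_range _ g]; exact hg
    exact this
  obtain ⟨w, hw⟩ := PrimeSpectrum.exists_eventually_specializes_of_etale (MvPolynomial (Fin n) k) r
  have he : Topology.IsOpenEmbedding (hV.fromSpec ∘ j) := hV.fromSpec.isOpenEmbedding.comp hj
  refine ⟨hV.fromSpec (j w), ?_⟩
  have hp : p = (hV.fromSpec ∘ j) r := (hq.symm.trans (congr_arg hV.fromSpec hr.symm) :)
  rw [hp, ← he.map_nhds_eq, Filter.eventually_map]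
  filter_upwards [hw] with z hz
  exact hz.map he.continuous

end LocallyIrreducible

/-! ### Rigidity of lifts and extension of sections of finite étale covers -/

namespace AlgebraicGeometry

/-- Two lifts along an unramified morphism agree if they do so set-theoretically on the diagonal. -/
theorem FormallyUnramified.eq_of_range_subset {X Y Z : Scheme.{u}} (f : Y ⟶ Z)
    [FormallyUnramified f] [LocallyOfFiniteType f] {u v : X ⟶ Y} (h : u ≫ f = v ≫ f)
    (hr : Set.range (pullback.lift u v h) ⊆ Set.range (pullback.diagonal f)) : u = v := by
  -- The diagonal is an open immersion, so the condition on points gives a factorization of `(u, v)`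
  -- through it.
  have hl := IsOpenImmersion.lift_fac (pullback.diagonal f) (pullback.lift u v h) hr
  have hu := hl =≫ pullback.fst f f
  have hv := hl =≫ pullback.snd f f
  simp only [Category.assoc, pullback.diagonal_fst, pullback.diagonal_snd, Category.comp_id,
    pullback.lift_fst, pullback.lift_snd] at hu hv
  exact hu.symm.trans hv

theorem isClopen_range_diagonal {Y Z : Scheme.{u}} (f : Y ⟶ Z) [FormallyUnramified f]
    [LocallyOfFiniteType f] [IsSeparated f] : IsClopen (Set.range (pullback.diagonal f)) :=
  ⟨(pullback.diagonal f).isClosedEmbedding.isClosed_range,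
    (pullback.diagonal f).isOpenEmbedding.isOpen_range⟩

/-- Two lifts of a morphism from a connected scheme along a separated unramified morphism agree as
soon as they agree on some nonempty scheme. -/
theorem FormallyUnramified.eq_of_comp_eq {W X Y Z : Scheme.{u}} [PreconnectedSpace X] (f : Y ⟶ Z)
    [FormallyUnramified f] [LocallyOfFiniteType f] [IsSeparated f] {u v : X ⟶ Y}
    (h : u ≫ f = v ≫ f) (w : W ⟶ X) [Nonempty W] (hw : w ≫ u = w ≫ v) : u = v := by
  refine eq_of_range_subset f h ?_
  have hclopen := (isClopen_range_diagonal f).preimage (pullback.lift u v h).continuous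
  have hne : (pullback.lift u v h ⁻¹' Set.range (pullback.diagonal f)).Nonempty := by
    obtain ⟨z⟩ := ‹Nonempty W›
    refine ⟨w z, (w ≫ u) z, ?_⟩
    have : (w ≫ u) ≫ pullback.diagonal f = w ≫ pullback.lift u v h := by
      apply pullback.hom_ext
      · rw [Category.assoc, pullback.diagonal_fst, Category.comp_id, Category.assoc,
          pullback.lift_fst]
      · rw [Category.assoc, pullback.diagonal_snd, Category.comp_id, Category.assoc,
          pullback.lift_snd, hw]
    rw [← Scheme.Hom.comp_apply, this, Scheme.Hom.comp_apply]
  rintro _ ⟨x, rfl⟩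
  exact (hclopen.eq_univ hne).ge (Set.mem_univ x)

/-- A finite étale morphism to a connected scheme is an isomorphism if it is a monomorphism after
base change to a generic point of a scheme below. -/
theorem isIso_of_finite_of_etale_of_generic {D X Y T : Scheme.{u}} (g : D ⟶ X) [IsFinite g]
    [Etale g] [Nonempty D] [PreconnectedSpace X] (p : X ⟶ Y) (hp : IsOpenMap p) (τ : T ⟶ Y) (t : T)
    (ht : IsGenericPoint (τ t) Set.univ)
    (h : ∀ {Z : Scheme.{u}} (u v : Z ⟶ D) (z : Z ⟶ T), u ≫ g = v ≫ g → u ≫ g ≫ p = z ≫ τ → u = v) :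
    IsIso g := by
  -- The complement of the diagonal is open; if nonempty, its open image in `Y` contains the generic
  -- point, so it meets the base change to `T`, where `h` identifies the two projections.
  have hsurj : Set.range (pullback.diagonal g) = Set.univ := by
    by_contra hne
    let q : pullback g g ⟶ Y := pullback.fst g g ≫ g ≫ p
    have hq : IsOpenMap q := by
      have := (hp.comp g.isOpenMap).comp (pullback.fst g g).isOpenMap
      convert! this using 1
    have hopen := hq _ (isClopen_range_diagonal g).compl.isOpen
    obtain ⟨w, hw, hwt⟩ : τ t ∈ q '' (Set.range (pullback.diagonal g))ᶜ := by
      rw [ht.mem_open_set_iff hopen, Set.univ_inter]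
      exact (Set.nonempty_compl.mpr hne).image _
    obtain ⟨z, hz, -⟩ := Scheme.Pullback.exists_preimage_pullback w t hwt
    have heq := h (pullback.fst q τ ≫ pullback.fst g g) (pullback.fst q τ ≫ pullback.snd g g)
      (pullback.snd q τ) (by simp [pullback.condition])
      (by rw [Category.assoc]; exact pullback.condition)
    have hfac : (pullback.fst q τ ≫ pullback.fst g g) ≫ pullback.diagonal g = pullback.fst q τ := by
      apply pullback.hom_ext <;> simp [heq]
    refine hw ⟨(pullback.fst q τ ≫ pullback.fst g g) z, ?_⟩
    rw [← Scheme.Hom.comp_apply, hfac, hz]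
  have : Mono g := ⟨fun u v huv ↦
    FormallyUnramified.eq_of_range_subset g huv (hsurj ▸ Set.subset_univ _)⟩
  have : Surjective g := ⟨Set.range_eq_univ.mp (IsClopen.eq_univ
    ⟨g.isClosedMap.isClosed_range, g.isOpenMap.isOpen_range⟩ (Set.range_nonempty g))⟩
  exact Flat.isIso_of_surjective_of_mono g

/-- A section over the generic fibre of a finite étale morphism with locally irreducible source
extends. -/
theorem exists_section_of_finite_of_etale_of_generic {P X Y F : Scheme.{u}} (g : P ⟶ X) [IsFinite g]
    [Etale g] [ConnectedSpace X] (p : X ⟶ Y) (hp : IsOpenMap p)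
    (hP : ∀ a : P, ∃ w, ∀ᶠ b in nhds a, w ⤳ b) {y : Y} (hy : IsGenericPoint y Set.univ)
    {i : F ⟶ X} {r : F ⟶ Spec (Y.residueField y)}
    (hF : IsPullback i r p (Y.fromSpecResidueField y)) (s : F ⟶ P) (hs : s ≫ g = i) :
    ∃ t : X ⟶ P, t ≫ g = 𝟙 X ∧ i ≫ t = s := by
  let q : P ⟶ Y := g ≫ p
  have hq : IsOpenMap q := by
    have := hp.comp g.isOpenMap
    convert! this using 1
  have hQ : IsPullback (q.fiberι y) (q.fiberToSpecResidueField y) q (Y.fromSpecResidueField y) :=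
    .of_hasPullback _ _
  let κ : q.fiber y ⟶ F := hF.lift (q.fiberι y ≫ g) (q.fiberToSpecResidueField y)
    (by simpa [q] using hQ.w)
  have hκ : IsPullback κ (q.fiberι y) i g := by
    refine IsPullback.of_right (h₁₂ := r) (h₂₂ := p) (v₁₃ := Y.fromSpecResidueField y) ?_ ?_ hF.flip
    · simpa [κ] using hQ.flip
    · simp [κ]
  have : Etale κ := MorphismProperty.of_isPullback hκ.flip ‹_›
  have : IsSeparated κ := MorphismProperty.of_isPullback hκ.flip (inferInstanceAs (IsSeparated g))
  -- `σ` is a section of the separated étale `κ`, hence an open and closed immersion.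
  let σ : F ⟶ q.fiber y := hQ.lift s r (by rw [← hF.w, ← hs, Category.assoc])
  have hσκ : σ ≫ κ = 𝟙 F := by
    apply hF.hom_ext <;> simp [σ, κ, hs]
  have hσs : σ ≫ q.fiberι y = s := hQ.lift_fst _ _ _
  have : Etale (σ ≫ κ) := hσκ ▸ inferInstance
  have : IsClosedImmersion (σ ≫ κ) := hσκ ▸ inferInstance
  have : Mono (σ ≫ κ) := hσκ ▸ inferInstance
  have : Mono σ := mono_of_mono σ κ
  have : Etale σ := Etale.of_comp σ κ
  have : IsOpenImmersion σ := IsOpenImmersion.of_flat_of_mono σ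
  have : IsClosedImmersion σ := IsClosedImmersion.of_comp σ κ
  let N : Set P := q ⁻¹' {y}
  have hN : Set.range (q.fiberι y) = N := q.range_fiberι y
  have hrange : Set.range s = q.fiberι y '' Set.range σ := by
    rw [← hσs, ← Set.range_comp]
    rfl
  have hspec {a b : P} (ha : a ∈ N) (hb : b ∈ N) (hab : a ⤳ b) :
      a ∈ Set.range s ↔ b ∈ Set.range s := by
    rw [← hN] at ha hb
    obtain ⟨a, rfl⟩ := ha
    obtain ⟨b, rfl⟩ := hb
    have hab' : a ⤳ b := (q.fiberι y).isEmbedding.isInducing.specializes_iff.mp hab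
    have hmem (c) : q.fiberι y c ∈ Set.range s ↔ c ∈ Set.range σ := by
      rw [hrange]
      exact (q.fiberι y).isEmbedding.injective.mem_set_image
    rw [hmem, hmem]
    exact ⟨fun h ↦ hab'.mem_closed σ.isClosedEmbedding.isClosed_range h,
      fun h ↦ hab'.mem_open σ.isOpenEmbedding.isOpen_range h⟩
  have hsN : Set.range s ⊆ N := by
    rw [← hN, hrange]
    exact Set.image_subset_range _ _
  -- Near a common point of the closures, one `w` specializes to points of both sets. It lies in `N`
  -- since `y` is generic, contradicting that the image of `s` is clopen in `N`.
  have hdisj : Disjoint (closure (Set.range s)) (closure (N \ Set.range s)) := by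
    rw [Set.disjoint_left]
    intro a ha ha'
    obtain ⟨w, hw⟩ := hP a
    obtain ⟨b, hb, hbU⟩ := mem_closure_iff_nhds.mp ha _ hw
    obtain ⟨c, hc, hcN, hcU⟩ := mem_closure_iff_nhds.mp ha' _ hw
    have hwN : w ∈ N := by
      have h1 : q w ⤳ y := by
        have := (show w ⤳ b from hb).map q.continuous
        rwa [show q b = y from hsN hbU] at this
      exact (h1.antisymm (hy.specializes (Set.mem_univ _))).eq
    exact hcU ((hspec hwN hcN hc).mp ((hspec hwN (hsN hbU) hb).mpr hbU))
  -- `N` is dense because `q` is open and `y` is generic.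
  have hunion : closure (Set.range s) ∪ closure (N \ Set.range s) = Set.univ := by
    rw [← closure_union, Set.union_sdiff_cancel hsN, ← dense_iff_closure_eq]
    rw [dense_iff_inter_open]
    intro O hO hOne
    obtain ⟨a, ha, hay⟩ : y ∈ q '' O := by
      rw [hy.mem_open_set_iff (hq _ hO), Set.univ_inter]
      exact hOne.image _
    exact ⟨a, ha, hay⟩
  have hcompl : IsCompl (closure (Set.range s)) (closure (N \ Set.range s)) :=
    ⟨hdisj, codisjoint_iff.mpr hunion⟩
  let D : P.Opens := ⟨closure (Set.range s), by
    rw [← hcompl.symm.compl_eq]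
    exact isClosed_closure.isOpen_compl⟩
  have : IsClosedImmersion D.ι := .of_isPreimmersion _ (by
    rw [Scheme.Opens.range_ι]; exact isClosed_closure)
  have hDN {a : P} (ha : a ∈ N) (haD : a ∈ D) : a ∈ Set.range s := by
    by_contra h
    exact Set.disjoint_left.mp hdisj haD (subset_closure ⟨ha, h⟩)
  have hsD : Set.range s ⊆ Set.range D.ι := by
    rw [Scheme.Opens.range_ι]; exact subset_closure
  have hFne : Nonempty F := by
    obtain ⟨x, hx⟩ : y ∈ Set.range p := by
      rw [hy.mem_open_set_iff hp.isOpen_range, Set.univ_inter]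
      exact Set.range_nonempty p
    have : x ∈ Set.range (p.fiberι y) := by rw [p.range_fiberι]; exact hx
    obtain ⟨z, -⟩ := this
    exact ⟨hF.lift (p.fiberι y) (p.fiberToSpecResidueField y) (p.fiber_fac y) z⟩
  let sD := IsOpenImmersion.lift D.ι s hsD
  have hsD : sD ≫ D.ι = s := IsOpenImmersion.lift_fac _ _ _
  have : Nonempty D := hFne.map sD
  -- Over the generic point, `D` is just the image of `s`, so a map to `D` is determined by its
  -- composite with `g`.
  have hu {Z : Scheme.{u}} (u : Z ⟶ D) (z : Z ⟶ Spec (Y.residueField y))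
      (h : u ≫ D.ι ≫ q = z ≫ Y.fromSpecResidueField y) :
      u ≫ D.ι = hF.lift (u ≫ D.ι ≫ g) z (by simpa [q] using h) ≫ s := by
    let uQ : Z ⟶ q.fiber y := hQ.lift (u ≫ D.ι) z (by simpa using h)
    have huQ : uQ ≫ q.fiberι y = u ≫ D.ι := hQ.lift_fst _ _ _
    have hr : Set.range uQ ⊆ Set.range σ := by
      rintro _ ⟨x, rfl⟩
      have h1 : q.fiberι y (uQ x) = D.ι (u x) := by
        rw [← Scheme.Hom.comp_apply, huQ, Scheme.Hom.comp_apply]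
      obtain ⟨f, hf⟩ := hDN (a := D.ι (u x)) (by rw [← h1, ← hN]; exact ⟨_, rfl⟩) (u x).2
      refine ⟨f, (q.fiberι y).isEmbedding.injective ?_⟩
      rw [h1, ← hf, ← hσs, Scheme.Hom.comp_apply]
    have hl := IsOpenImmersion.lift_fac σ uQ hr
    rw [← huQ, ← hl, Category.assoc, hσs]
    congr 1
    have h2 : IsOpenImmersion.lift σ uQ hr = uQ ≫ κ := by
      conv_rhs => rw [← hl, Category.assoc, hσκ, Category.comp_id]
    rw [h2]
    apply hF.hom_ext <;> simp [κ, uQ]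
  have : IsIso (D.ι ≫ g) := by
    refine isIso_of_finite_of_etale_of_generic (D.ι ≫ g) p hp (Y.fromSpecResidueField y)
      (IsLocalRing.closedPoint _) ?_ ?_
    · convert! hy
      exact Scheme.fromSpecResidueField_apply _ _
    · intro Z u v z huv hz
      have hv : v ≫ (D.ι ≫ g) ≫ p = z ≫ Y.fromSpecResidueField y := by
        rw [← Category.assoc, ← huv, Category.assoc, hz]
      rw [← cancel_mono D.ι, hu u z (by simpa [q] using hz), hu v z (by simpa [q] using hv)]
      congr 2
  refine ⟨inv (D.ι ≫ g) ≫ D.ι, by simp, ?_⟩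
  have : i = sD ≫ D.ι ≫ g := by rw [reassoc_of% hsD, hs]
  rw [this]
  simp [hsD]

end AlgebraicGeometry

namespace EtaleIsogeny

/-! ### Translations and shear maps in a cartesian category -/

section Cartesian

variable {C : Type*} [Category C] [CartesianMonoidalCategory C]

theorem lift_comp_translation {X T Z : C} (m : X ⊗ X ⟶ X) (x : T ⟶ X) (a : Z ⟶ X) (t : Z ⟶ T) :
    lift a t ≫ translation m x = lift (lift a (t ≫ x) ≫ m) t := by
  ext <;> simp [translation]

@[simp]
theorem translation_snd {X T : C} (m : X ⊗ X ⟶ X) (x : T ⟶ X) :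
    translation m x ≫ snd X T = snd X T := by
  simp [translation]

@[simp]
theorem translation_fst {X T : C} (m : X ⊗ X ⟶ X) (x : T ⟶ X) :
    translation m x ≫ fst X T = (X ◁ x) ≫ m := by
  simp [translation]

/-- Translation by `x⁻¹` is the inverse. -/
theorem isIso_translation {G T : C} [GrpObj G] (x : T ⟶ G) : IsIso (translation μ[G] x) := by
  have key (z : T ⟶ G) (w : T ⟶ G) (h : z * w = 1) :
      translation μ[G] z ≫ translation μ[G] w = 𝟙 _ := by
    rw [translation, lift_comp_translation]
    have h1 : (G ◁ z) ≫ μ = fst G T * (snd G T ≫ z) := by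
      rw [Hom.mul_def]; congr 1; ext <;> simp
    have h2 : lift (fst G T * (snd G T ≫ z)) (snd G T ≫ w) ≫ μ = fst G T := by
      rw [← Hom.mul_def, _root_.mul_assoc, ← comp_mul, h, comp_one, _root_.mul_one]
    rw [h1, h2]
    ext <;> simp
  exact ⟨translation μ[G] x⁻¹, key _ _ (mul_inv_cancel x), key _ _ (inv_mul_cancel x)⟩

/-- A monoid object whose shear map `(x, y) ↦ (x y, y)` is an isomorphism is a group object. -/
@[reducible]
noncomputable def grpObjOfIsIso {H : C} [MonObj H] [IsIso (translation μ[H] (𝟙 H))] : GrpObj H :=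
  -- The preimage of `(1, y)` under the shear map, that is, `(y⁻¹, y)`.
  let w : H ⟶ H ⊗ H := lift (toUnit H ≫ η) (𝟙 H) ≫ inv (translation μ[H] (𝟙 H))
  have hw2 : w ≫ snd H H = 𝟙 H := by
    rw [Category.assoc, (IsIso.inv_comp_eq _).mpr (translation_snd _ _).symm, lift_snd]
  have hw : lift (w ≫ fst H H) (𝟙 H) ≫ μ = toUnit H ≫ η := by
    have h1 : lift (w ≫ fst H H) (𝟙 H) = w := by ext <;> simp [hw2]
    have h2 : w ≫ translation μ[H] (𝟙 H) = lift (toUnit H ≫ η) (𝟙 H) := by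
      rw [Category.assoc, IsIso.inv_hom_id, Category.comp_id]
    have h3 := h2 =≫ fst H H
    rw [Category.assoc, translation_fst, whiskerLeft_id, Category.id_comp, lift_fst] at h3
    rw [h1, h3]
  have hl : (w ≫ fst H H) * 𝟙 H = 1 := hw
  { inv := w ≫ fst H H
    left_inv := hw
    -- The inverse of the inverse is a left inverse of `w ≫ fst H H`, and the identity is a right
    -- inverse of it, so the two agree.
    right_inv := by
      have h1 : ((w ≫ fst H H) ≫ (w ≫ fst H H)) * (w ≫ fst H H) = 1 := by
        have := (w ≫ fst H H) ≫= hl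
        rwa [comp_mul, comp_one, Category.comp_id] at this
      exact ((left_inv_eq_right_inv h1 hl) ▸ h1 : 𝟙 H * (w ≫ fst H H) = 1) }

end Cartesian

/-! ### Rigidity, extension and torsors for schemes over a base -/

section Over

variable {S : Scheme.{u}}

theorem isPullback_whiskerLeft_left {X T T' : Over S} (q : T' ⟶ T) :
    IsPullback (X ◁ q).left (snd X T').left (snd X T).left q.left := by
  have h : IsPullback (X ◁ q) (snd X T') (snd X T) q :=
    ⟨⟨by simp⟩, ⟨PullbackCone.IsLimit.mk _ (fun s ↦ lift (s.fst ≫ fst X T) s.snd)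
      (fun s ↦ by ext1 <;> simp [s.condition]) (fun s ↦ by simp)
      (fun s m h₁ h₂ ↦ by
        ext1
        · simp [← h₁]
        · simpa using h₂)⟩⟩
  exact h.map (Over.forget S)

theorem isPullback_whiskerRight_left {X T T' : Over S} (q : T' ⟶ T) :
    IsPullback (q ▷ X).left (fst T' X).left (fst T X).left q.left := by
  have h : IsPullback (q ▷ X) (fst T' X) (fst T X) q :=
    ⟨⟨by simp⟩, ⟨PullbackCone.IsLimit.mk _ (fun s ↦ lift s.snd (s.fst ≫ snd T X))
      (fun s ↦ by ext1 <;> simp [s.condition]) (fun s ↦ by simp)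
      (fun s m h₁ h₂ ↦ by
        ext1
        · simpa using h₂
        · simp [← h₁])⟩⟩
  exact h.map (Over.forget S)

theorem isPullback_snd_left (X Y : Over S) :
    IsPullback (fst X Y).left (snd X Y).left X.hom Y.hom :=
  IsPullback.of_hasPullback _ _

/-- Stability under base change and composition passes to products of morphisms of `S`-schemes. -/
theorem tensorHom_left_mem (P : MorphismProperty Scheme.{u}) [P.IsStableUnderBaseChange]
    [P.IsStableUnderComposition] {X Y X' Y' : Over S} (f : X ⟶ Y) (g : X' ⟶ Y') (hf : P f.left)
    (hg : P g.left) : P (f ⊗ₘ g).left := by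
  rw [MonoidalCategory.tensorHom_def, Over.comp_left]
  exact P.comp_mem _ _ (P.of_isPullback (isPullback_whiskerRight_left f).flip hf)
    (P.of_isPullback (isPullback_whiskerLeft_left g).flip hg)

theorem smooth_tensorObj_hom (X Y : Over S) [Smooth X.hom] [Smooth Y.hom] :
    Smooth (X ⊗ Y).hom :=
  inferInstanceAs (Smooth (pullback.fst X.hom Y.hom ≫ X.hom))

theorem connectedSpace_tensorObj_left (X Y : Over S) [GeometricallyConnected X.hom]
    [UniversallyOpen X.hom] [ConnectedSpace Y.left] : ConnectedSpace (X ⊗ Y).left :=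
  inferInstanceAs (ConnectedSpace (pullback X.hom Y.hom :))

/-- Two lifts of a morphism from a connected `S`-scheme along a separated unramified morphism agree
as soon as they agree on some nonempty `S`-scheme. -/
theorem eq_of_comp_eq_over {W X H G : Over S} [PreconnectedSpace X.left] (f : H ⟶ G)
    [FormallyUnramified f.left] [LocallyOfFiniteType f.left] [IsSeparated f.left] {u v : X ⟶ H}
    (h : u ≫ f = v ≫ f) (w : W ⟶ X) [Nonempty W.left] (hw : w ≫ u = w ≫ v) : u = v := by
  ext1
  exact FormallyUnramified.eq_of_comp_eq f.left (congr_arg Over.Hom.left h) w.left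
    (congr_arg Over.Hom.left hw)

/-- Two lifts along an unramified morphism agree if they do so on a jointly surjective family. -/
theorem eq_of_forall_exists_comp_eq {X H G : Over S} (f : H ⟶ G)
    [FormallyUnramified f.left] [LocallyOfFiniteType f.left] {u v : X ⟶ H} (h : u ≫ f = v ≫ f)
    (hw : ∀ x : X.left, ∃ (W : Over S) (w : W ⟶ X), x ∈ Set.range w.left ∧ w ≫ u = w ≫ v) :
    u = v := by
  have h' : u.left ≫ f.left = v.left ≫ f.left := congr_arg Over.Hom.left h
  ext1
  refine FormallyUnramified.eq_of_range_subset f.left h' ?_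
  rintro _ ⟨x, rfl⟩
  obtain ⟨W, w, ⟨z, rfl⟩, hw⟩ := hw x
  have hw' : w.left ≫ u.left = w.left ≫ v.left := congr_arg Over.Hom.left hw
  refine ⟨(w.left ≫ u.left) z, ?_⟩
  have : (w.left ≫ u.left) ≫ pullback.diagonal f.left = w.left ≫ pullback.lift u.left v.left h' := by
    apply pullback.hom_ext
    · rw [Category.assoc, pullback.diagonal_fst, Category.comp_id, Category.assoc, pullback.lift_fst]
    · rw [Category.assoc, pullback.diagonal_snd, Category.comp_id, Category.assoc, pullback.lift_snd,
        hw']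
  rw [← Scheme.Hom.comp_apply, this, Scheme.Hom.comp_apply]

/-- Testing in the slice category suffices: a scheme mapping to `D` inherits its structure morphism
to `S`. -/
theorem isIso_of_finite_of_etale_of_generic_over {D X Y T : Over S} (g : D ⟶ X) [IsFinite g.left]
    [Etale g.left] [Nonempty D.left] [PreconnectedSpace X.left] (p : X ⟶ Y) (hp : IsOpenMap p.left)
    (τ : T ⟶ Y) (t : T.left) (ht : IsGenericPoint (τ.left t) Set.univ)
    (h : ∀ {Z : Over S} (u v : Z ⟶ D) (z : Z ⟶ T), u ≫ g = v ≫ g → u ≫ g ≫ p = z ≫ τ → u = v) :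
    IsIso g := by
  have : IsIso g.left := by
    refine isIso_of_finite_of_etale_of_generic g.left p.left hp τ.left t ht ?_
    intro Z u v z huv hz
    have hg := Over.w g
    have hv : v ≫ D.hom = u ≫ D.hom := by rw [← hg, ← reassoc_of% huv]
    have hz' : z ≫ T.hom = u ≫ D.hom := by
      rw [← Over.w τ, ← reassoc_of% hz, Over.w p, Over.w g]
    have := h (Z := Over.mk (u ≫ D.hom)) (Over.homMk u) (Over.homMk v hv) (Over.homMk z hz')
      (by ext1; exact huv) (by ext1; exact hz)
    exact congr_arg Over.Hom.left this
  exact (isIso_iff_of_reflects_iso g (Over.forget S)).mp this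

/-- Let `f : H ⟶ G` be finite étale. A lift along `f` of a morphism `m : X ⟶ G` that is defined over
the generic fibre of `X ⟶ Y` extends to `X`. -/
theorem exists_lift_of_generic_over {X Y F H G : Over S} (f : H ⟶ G) [IsFinite f.left]
    [Etale f.left] (m : X ⟶ G) [ConnectedSpace X.left] (p : X ⟶ Y) (hp : IsOpenMap p.left)
    (hX : ∀ (P : Scheme.{u}) (g : P ⟶ X.left) [Etale g] (a : P), ∃ w, ∀ᶠ b in nhds a, w ⤳ b)
    {y : Y.left} (hy : IsGenericPoint y Set.univ) {i : F ⟶ X} {r : F ⟶ residuePoint Y y}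
    (hF : IsPullback i.left r.left p.left (residuePointMap Y y).left) (s : F ⟶ H)
    (hs : s ≫ f = i ≫ m) : ∃ t : X ⟶ H, t ≫ f = m ∧ i ≫ t = s := by
  -- Lifts of `m` along `f` are sections of the pullback of `f` along `m`.
  obtain ⟨t, ht, hit⟩ := exists_section_of_finite_of_etale_of_generic
    (pullback.snd f.left m.left) p.left hp (hX _ (pullback.snd f.left m.left))
    hy hF
    (pullback.lift s.left i.left (congr_arg Over.Hom.left hs)) (pullback.lift_snd _ _ _)
  have h1 : (t ≫ pullback.fst f.left m.left) ≫ f.left = m.left := by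
    rw [Category.assoc, pullback.condition, reassoc_of% ht]
  refine ⟨Over.homMk (t ≫ pullback.fst f.left m.left) ?_, ?_, ?_⟩
  · rw [← Over.w f, ← Category.assoc, h1, Over.w m]
  · ext1; exact h1
  · ext1
    change i.left ≫ t ≫ pullback.fst f.left m.left = s.left
    rw [reassoc_of% hit, pullback.lift_fst]

/-- Any two points with values in a connected one-point scheme in the same fibre of a torsor are
conjugate. -/
theorem IsTorsor.exists_eq_comp {X Y T : Scheme.{u}} {f : X ⟶ Y} {A : Type v} [Group A] [Finite A]
    {ρ : A →* Aut (Over.mk f)} (hf : IsTorsor f ρ) [Subsingleton T] [Nonempty T] {u w : T ⟶ X}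
    (h : u ≫ f = w ≫ f) : ∃ a : A, u = w ≫ (ρ a).hom.left := by
  let φ (a : A) : X ⟶ pullback f f := pullback.lift (f := f) (g := f) (ρ a).hom.left (𝟙 X)
    ((Over.w (ρ a).hom).trans (Category.id_comp f).symm)
  let shear : (∐ fun _ : A ↦ X) ⟶ pullback f f := Sigma.desc φ
  have : IsIso shear := hf.isIso_shear
  obtain ⟨t⟩ := ‹Nonempty T›
  let l : T ⟶ ∐ fun _ : A ↦ X := pullback.lift u w h ≫ inv shear
  obtain ⟨a, x, hx⟩ : ∃ (a : A) (x : X), Sigma.ι (fun _ : A ↦ X) a x = l t :=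
    (sigmaOpenCover fun _ : A ↦ X).exists_eq (l t)
  -- A one-point scheme maps into a single component of the coproduct, which names `a`.
  have hr : Set.range l ⊆ Set.range (Sigma.ι (fun _ : A ↦ X) a) := by
    rintro _ ⟨t', rfl⟩
    exact ⟨x, by rw [Subsingleton.elim t' t]; exact hx⟩
  have hl := IsOpenImmersion.lift_fac (Sigma.ι (fun _ : A ↦ X) a) l hr
  set b := IsOpenImmersion.lift (Sigma.ι (fun _ : A ↦ X) a) l hr
  have hb : b ≫ φ a = pullback.lift u w h := by
    rw [← Sigma.ι_desc φ a, ← Category.assoc, hl, Category.assoc, IsIso.inv_hom_id,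
      Category.comp_id]
  have hb1 := hb =≫ pullback.fst f f
  have hb2 := hb =≫ pullback.snd f f
  rw [Category.assoc, pullback.lift_fst, pullback.lift_fst] at hb1
  rw [Category.assoc, pullback.lift_snd, pullback.lift_snd, Category.comp_id] at hb2
  exact ⟨a, by rw [← hb1, hb2]⟩

end Over

/-! ### Descent along a field extension -/

section Descent

variable {S : Scheme.{u}}

/-- Reduces equality of lifts on `X × R`, for `R` possibly disconnected, to the fibres over points
of `R`. -/
theorem exists_mem_range_whiskerLeft_residuePointMap {X R : Over S} (x : (X ⊗ R).left) :
    x ∈ Set.range (X ◁ residuePointMap R ((snd X R).left x)).left := by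
  obtain ⟨z, hz, -⟩ := Scheme.exists_preimage_of_isPullback (isPullback_whiskerLeft_left (X := X)
    (residuePointMap R ((snd X R).left x))) x
    (IsLocalRing.closedPoint (R.left.residueField ((snd X R).left x)) :)
    (Scheme.fromSpecResidueField_apply _ _).symm
  exact ⟨z, hz⟩

/-- Let `H` be geometrically connected over `S` and let `s'` be a `T'`-family of morphisms to `H`
lifting a `T`-family of morphisms to `G`, along an unramified morphism, where `T' ⟶ T` is an fpqc
covering. If the value of `s'` at some `S`-point of `H` descends to `T`, then so does `s'`. -/
theorem exists_whiskerLeft_comp_eq {H G T T' : Over S} (f : H ⟶ G) [FormallyUnramified f.left]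
    [LocallyOfFiniteType f.left] [IsSeparated f.left] [GeometricallyConnected H.hom]
    [UniversallyOpen H.hom] (q : T' ⟶ T) [Flat q.left] [Surjective q.left] [QuasiCompact q.left]
    (s' : H ⊗ T' ⟶ H) (m : H ⊗ T ⟶ G) (hs : s' ≫ f = (H ◁ q) ≫ m) (e : 𝟙_ (Over S) ⟶ H) (j : T ⟶ H)
    (he : lift (toUnit T' ≫ e) (𝟙 T') ≫ s' = q ≫ j) :
    ∃ s : H ⊗ T ⟶ H, (H ◁ q) ≫ s = s' ∧ s ≫ f = m := by
  have hT {R : Over S} (t : R ⟶ T') : lift (toUnit R ≫ e) t ≫ s' = t ≫ q ≫ j := by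
    rw [← he, ← Category.assoc, comp_lift]
    simp
  -- Each fibre `H × Spec κ(r)` is connected, and along `e` both sides take the value `t ≫ q ≫ j`,
  -- which depends only on `t ≫ q`.
  have key {R : Over S} (t₁ t₂ : R ⟶ T') (ht : t₁ ≫ q = t₂ ≫ q) :
      (H ◁ t₁) ≫ s' = (H ◁ t₂) ≫ s' := by
    have hf : ((H ◁ t₁) ≫ s') ≫ f = ((H ◁ t₂) ≫ s') ≫ f := by
      simp only [Category.assoc, hs, ← whiskerLeft_comp_assoc, ht]
    refine eq_of_forall_exists_comp_eq f hf fun x ↦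
      ⟨_, _, exists_mem_range_whiskerLeft_residuePointMap x, ?_⟩
    set r := (snd H R).left x
    have : ConnectedSpace (residuePoint R r).left :=
      inferInstanceAs (ConnectedSpace (Spec (R.left.residueField r)))
    have := connectedSpace_tensorObj_left H (residuePoint R r)
    refine eq_of_comp_eq_over f (by simp only [Category.assoc] at hf ⊢; rw [hf])
      (lift (toUnit _ ≫ e) (𝟙 (residuePoint R r))) ?_
    simp only [lift_whiskerLeft_assoc, Category.id_comp]
    simp [hT, reassoc_of% ht]
  have hpb := isPullback_whiskerLeft_left (X := H) q
  have : Flat (H ◁ q).left := MorphismProperty.of_isPullback hpb.flip ‹_›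
  have : Surjective (H ◁ q).left := MorphismProperty.of_isPullback hpb.flip ‹_›
  have : QuasiCompact (H ◁ q).left := MorphismProperty.of_isPullback hpb.flip ‹_›
  have hdesc {Z : Scheme.{u}} (g₁ g₂ : Z ⟶ (H ⊗ T').left)
      (hg : g₁ ≫ (H ◁ q).left = g₂ ≫ (H ◁ q).left) : g₁ ≫ s'.left = g₂ ≫ s'.left := by
    let Z' : Over S := Over.mk (g₁ ≫ (H ⊗ T').hom)
    let a₁ : Z' ⟶ H ⊗ T' := Over.homMk g₁ rfl
    let a₂ : Z' ⟶ H ⊗ T' := Over.homMk g₂ (by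
      change g₂ ≫ _ = g₁ ≫ _
      rw [← Over.w (H ◁ q), reassoc_of% hg])
    have ha : a₁ ≫ (H ◁ q) = a₂ ≫ (H ◁ q) := Over.OverMorphism.ext hg
    have h1 : a₁ ≫ fst H T' = a₂ ≫ fst H T' := by simpa using ha =≫ fst H T
    have h2 : (a₁ ≫ snd H T') ≫ q = (a₂ ≫ snd H T') ≫ q := by simpa using ha =≫ snd H T
    have h3 (a : Z' ⟶ H ⊗ T') :
        lift (a ≫ fst H T') (𝟙 Z') ≫ (H ◁ (a ≫ snd H T')) = a := by
      ext1 <;> simp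
    have : a₁ ≫ s' = a₂ ≫ s' := by
      rw [← h3 a₁, ← h3 a₂, Category.assoc, Category.assoc, key _ _ h2, h1]
    exact congr_arg Over.Hom.left this
  let s : H ⊗ T ⟶ H := Over.homMk (EffectiveEpi.desc (H ◁ q).left s'.left hdesc) (by
    rw [← cancel_epi (H ◁ q).left, EffectiveEpi.fac_assoc, Over.w, Over.w])
  have hs' : (H ◁ q) ≫ s = s' :=
    Over.OverMorphism.ext (EffectiveEpi.fac (H ◁ q).left s'.left hdesc)
  refine ⟨s, hs', ?_⟩
  have : Epi (H ◁ q) := (Over.forget S).epi_of_epi_map (inferInstanceAs (Epi (H ◁ q).left))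
  rwa [← hs', Category.assoc, cancel_epi] at hs

end Descent

/-! ### Construction of the group law -/

/-- Used for the generic point, and for the identity of `H`, where the translation is the shear map.
-/
theorem translation_comp_tensorHom {C : Type*} [Category C] [CartesianMonoidalCategory C]
    {H G T T' : C} {f : H ⟶ G} {n : H ⊗ H ⟶ H} {m : G ⊗ G ⟶ G} (hn : n ≫ f = (f ⊗ₘ f) ≫ m)
    {x : T' ⟶ H} {q : T' ⟶ T} {z : T ⟶ G} (hz : q ≫ z = x ≫ f) :
    translation n x ≫ (f ⊗ₘ q) = (f ⊗ₘ q) ≫ translation m z := by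
  ext
  · have h : (H ◁ x) ≫ (f ⊗ₘ f) = (f ⊗ₘ q) ≫ (G ◁ z) := by
      ext <;> simp [hz]
    rw [Category.assoc, tensorHom_fst, reassoc_of% (translation_fst n x), hn, reassoc_of% h,
      Category.assoc, translation_fst]
  · simp [reassoc_of% (translation_snd n x)]

section

variable {S : Scheme.{u}}

theorem connectedSpace_tensorObj_left' (X Y : Over S) [GeometricallyConnected Y.hom]
    [UniversallyOpen Y.hom] [ConnectedSpace X.left] : ConnectedSpace (X ⊗ Y).left :=
  inferInstanceAs (ConnectedSpace (pullback X.hom Y.hom :))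

theorem residuePointHom_comp_residuePointMap {X Y : Over S} (f : X ⟶ Y) {x : X.left} {y : Y.left}
    (h : f.left x = y) :
    residuePointHom f h ≫ residuePointMap Y y = residuePointMap X x ≫ f := by
  subst h
  ext1
  simp [residuePointHom, residuePointMap]

theorem residuePointMap_left_apply (X : Over S) (x : X.left) (t : (residuePoint X x).left) :
    (residuePointMap X x).left t = x :=
  Scheme.fromSpecResidueField_apply _ _

/-- If the fibre of a torsor over an `S`-point has an `S`-point, then any point of this fibre with
values in a one-point scheme comes from an `S`-point. -/
theorem IsTorsor.exists_toUnit_comp_eq {H G T : Over S} {f : H ⟶ G} {A : Type v} [Group A]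
    [Finite A] {ρ : A →* Aut (Over.mk f.left)} (hf : IsTorsor f.left ρ) [Subsingleton T.left]
    [Nonempty T.left] {ε : 𝟙_ (Over S) ⟶ H} {η' : 𝟙_ (Over S) ⟶ G} (hε : ε ≫ f = η') (u : T ⟶ H)
    (hu : u ≫ f = toUnit T ≫ η') : ∃ e : 𝟙_ (Over S) ⟶ H, e ≫ f = η' ∧ toUnit T ≫ e = u := by
  have h : u ≫ f = (toUnit T ≫ ε) ≫ f := by rw [hu, Category.assoc, hε]
  -- `A` acts by `S`-automorphisms, so the translate of `ε` by `a` is again an `S`-point.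
  obtain ⟨a, ha⟩ := hf.exists_eq_comp (u := u.left) (w := (toUnit T ≫ ε).left)
    (congr_arg Over.Hom.left h)
  have hra : (ρ a).hom.left ≫ f.left = f.left := Over.w (ρ a).hom
  let r : H ⟶ H := Over.homMk (ρ a).hom.left (by
    change (ρ a).hom.left ≫ H.hom = H.hom
    rw [← Over.w f, reassoc_of% hra])
  have hr : r ≫ f = f := Over.OverMorphism.ext hra
  refine ⟨ε ≫ r, by rw [Category.assoc, hr, hε], ?_⟩
  rw [← Category.assoc]
  exact Over.OverMorphism.ext ha.symm

/-- Let `f : H ⟶ G` be a finite étale morphism to a group scheme, with `H` geometrically connected.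
A binary operation on `H` lifting the multiplication of `G` is a group structure if it has a left
unit over the unit of `G` and its translation by some generic point is an isomorphism. -/
theorem mem_groupStructures {H G T : Over S} [GrpObj G] (f : H ⟶ G) [IsFinite f.left]
    [Etale f.left] [GeometricallyConnected H.hom] [UniversallyOpen H.hom] [ConnectedSpace S]
    (n : H ⊗ H ⟶ H) (hn : n ≫ f = (f ⊗ₘ f) ≫ μ[G]) (e : 𝟙_ (Over S) ⟶ H) (he : e ≫ f = η[G])
    (x : T ⟶ H) (t : T.left) (ht : IsGenericPoint (x.left t) Set.univ)
    (hx : lift (toUnit T ≫ e) x ≫ n = x) [IsIso (translation n x)] :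
    n ∈ groupStructures f := by
  have : Nonempty T.left := ⟨t⟩
  have : ConnectedSpace (𝟙_ (Over S)).left := inferInstanceAs (ConnectedSpace S)
  have : ConnectedSpace H.left :=
    GeometricallyConnected.connectedSpace H.hom H.hom.isOpenMap
  have := connectedSpace_tensorObj_left H H
  have := connectedSpace_tensorObj_left H (𝟙_ (Over S))
  have := connectedSpace_tensorObj_left' (𝟙_ (Over S)) H
  have := connectedSpace_tensorObj_left' (H ⊗ H) H
  have hone : lift (toUnit H ≫ e) (𝟙 H) ≫ n = 𝟙 H := by
    refine eq_of_comp_eq_over f ?_ x ?_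
    · simp only [Category.assoc, hn, lift_map_assoc, he, Category.id_comp]
      exact _root_.one_mul f
    · rw [comp_lift_assoc, comp_toUnit_assoc, Category.comp_id, hx]
  have hee : lift e e ≫ n = e := by
    simpa [comp_lift_assoc] using e ≫= hone
  have hshear : translation n (𝟙 H) ≫ (f ⊗ₘ f) = (f ⊗ₘ f) ≫ translation μ[G] (𝟙 G) :=
    translation_comp_tensorHom hn (by simp)
  have hff : IsFinite (f ⊗ₘ f).left := tensorHom_left_mem @IsFinite f f ‹_› ‹_›
  have hfe : Etale (f ⊗ₘ f).left := by
    have : MorphismProperty.IsStableUnderComposition @Etale :=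
      ⟨fun _ _ _ _ ↦ inferInstance⟩
    exact tensorHom_left_mem @Etale f f ‹_› ‹_›
  have : IsIso (translation μ[G] (𝟙 G)) := isIso_translation _
  have : IsIso (translation μ[G] (𝟙 G)).left :=
    inferInstanceAs (IsIso ((Over.forget S).map (translation μ[G] (𝟙 G))))
  have hcf : IsFinite ((translation n (𝟙 H)).left ≫ (f ⊗ₘ f).left) := by
    rw [← Over.comp_left, hshear, Over.comp_left]
    infer_instance
  have hce : Etale ((translation n (𝟙 H)).left ≫ (f ⊗ₘ f).left) := by
    rw [← Over.comp_left, hshear, Over.comp_left]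
    infer_instance
  have : IsFinite (translation n (𝟙 H)).left := IsFinite.of_comp _ (f ⊗ₘ f).left
  have : Etale (translation n (𝟙 H)).left := Etale.of_comp _ (f ⊗ₘ f).left
  have : UniversallyOpen (snd H H).left :=
    MorphismProperty.of_isPullback (isPullback_snd_left H H) ‹_›
  -- Over the generic point `x` of the second factor, the shear map becomes the isomorphism
  -- `translation n x`.
  have hiso : IsIso (translation n (𝟙 H)) := by
    refine isIso_of_finite_of_etale_of_generic_over (translation n (𝟙 H)) (snd H H)
      (snd H H).left.isOpenMap x t ht ?_
    intro Z u v z huv hz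
    have hu : u ≫ snd H H = z ≫ x := by simpa using hz
    have hv : v ≫ snd H H = z ≫ x := by
      rw [← hu]
      simpa using (huv =≫ snd H H).symm
    have hlift (w : Z ⟶ H ⊗ H) (hw : w ≫ snd H H = z ≫ x) :
        lift (w ≫ fst H H) z ≫ translation n x = lift (w ≫ n) z := by
      rw [lift_comp_translation, ← hw]
      congr 2
      ext <;> simp
    have h1 : u ≫ n = v ≫ n := by simpa using huv =≫ fst H H
    have h2 : lift (u ≫ fst H H) z = lift (v ≫ fst H H) z := by
      rw [← cancel_mono (translation n x), hlift u hu, hlift v hv, h1]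
    ext1
    · simpa using h2 =≫ fst H T
    · rw [hu, hv]
  have hmul {Z : Over S} (a b : Z ⟶ H) : lift a b ≫ n ≫ f = (a ≫ f) * (b ≫ f) := by
    rw [hn, lift_map_assoc, Hom.mul_def]
  -- Both sides of each axiom lift the same map to `G`, so they need comparing only at `(1, x)`, at
  -- `e`, and at `(e, e, e)` respectively.
  let _ : MonObj H :=
    { one := e
      mul := n
      one_mul := by
        refine eq_of_comp_eq_over f ?_ (lift (toUnit T) x) ?_
        · have h1 : e ▷ H = lift (fst _ _ ≫ e) (snd _ _) :=
            CartesianMonoidalCategory.hom_ext _ _ (by simp) (by simp)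
          rw [h1, Category.assoc, hmul, Category.assoc, he, one_eq_one, comp_one,
            _root_.one_mul, leftUnitor_hom]
        · rw [lift_whiskerRight_assoc, hx]
          simp
      mul_one := by
        refine eq_of_comp_eq_over f ?_ (lift e (𝟙 _)) ?_
        · have h1 : H ◁ e = lift (fst _ _) (snd _ _ ≫ e) :=
            CartesianMonoidalCategory.hom_ext _ _ (by simp) (by simp)
          rw [h1, Category.assoc, hmul, Category.assoc, he, one_eq_one, comp_one,
            _root_.mul_one, rightUnitor_hom]
        · rw [lift_whiskerLeft_assoc, Category.id_comp, hee]
          simp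
      mul_assoc := by
        refine eq_of_comp_eq_over f ?_ (lift (lift e e) e) ?_
        · have h1 : n ▷ H = lift (lift (fst _ _ ≫ fst _ _) (fst _ _ ≫ snd _ _) ≫ n) (snd _ _) :=
            CartesianMonoidalCategory.hom_ext _ _ (by simp) (by simp)
          have h2 : (α_ H H H).hom ≫ (H ◁ n) =
              lift (fst _ _ ≫ fst _ _) (lift (fst _ _ ≫ snd _ _) (snd _ _) ≫ n) :=
            CartesianMonoidalCategory.hom_ext _ _ (by simp) (by
              rw [Category.assoc, whiskerLeft_snd, lift_snd, ← Category.assoc]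
              congr 1
              exact CartesianMonoidalCategory.hom_ext _ _ (by simp) (by simp))
          rw [reassoc_of% h2, h1]
          simp only [Category.assoc, hmul, _root_.mul_assoc]
        · simp [hee] }
  have : IsIso (translation μ[H] (𝟙 H)) := hiso
  exact ⟨grpObjOfIsIso, rfl, ⟨he, hn⟩⟩

end

/-- An isomorphism over an extension of the generic point of `H` that lifts the translation by the
generic point of `G` comes from a group structure on `H`. -/
theorem exists_mem_groupStructures {k : Type u} [Field k]
    {G H T : Over (Spec (CommRingCat.of k))} [GrpObj G] [Smooth G.hom] [GeometricallyConnected H.hom]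
    {A : Type v} [Group A] [Finite A] (f : H ⟶ G) (ρ : A →* Aut (Over.mk f.left))
    (hf : IsTorsor f.left ρ) (ε₁ : 𝟙_ (Over (Spec (CommRingCat.of k))) ⟶ H) (hε₁ : ε₁ ≫ f = η[G])
    {y : H.left} (hy : IsGenericPoint y Set.univ) (q : T ⟶ residuePoint H y) [Flat q.left]
    [Surjective q.left] [QuasiCompact q.left] [Subsingleton T.left] [ConnectedSpace T.left]
    (n' : H ⊗ T ⟶ H ⊗ T) (hiso : IsIso n') (hsnd : n' ≫ snd H T = snd H T)
    (hn' : n' ≫ fst H T ≫ f = (H ◁ (q ≫ residuePointMap H y)) ≫ (f ⊗ₘ f) ≫ μ[G]) :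
    ∃ n ∈ groupStructures f, translation n (q ≫ residuePointMap H y) = n' := by
  have := hf.finite
  have := hf.etale
  have : Smooth H.hom := by rw [← Over.w f]; infer_instance
  have : ConnectedSpace H.left := GeometricallyConnected.connectedSpace H.hom H.hom.isOpenMap
  have := connectedSpace_tensorObj_left H H
  set j := residuePointMap H y
  set x' := q ≫ j with hx'
  let s' : H ⊗ T ⟶ H := n' ≫ fst _ _
  let m : H ⊗ H ⟶ G := (f ⊗ₘ f) ≫ μ[G]
  have hs' : s' ≫ f = (H ◁ q) ≫ (H ◁ j) ≫ m := by
    rw [Category.assoc, hn', hx', whiskerLeft_comp, Category.assoc]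
  -- The point that `n'` carries to `x'`: its first component must be the unit of the group law
  -- sought.
  let w : T ⟶ H ⊗ T := lift x' (𝟙 _) ≫ inv n'
  have hws : w ≫ snd _ _ = 𝟙 _ := by
    rw [Category.assoc, (IsIso.inv_comp_eq _).mpr hsnd.symm, lift_snd]
  have hwn : w ≫ s' = x' := by simp [w, s']
  have hwf : w ≫ fst _ _ ≫ f = toUnit _ ≫ η[G] := by
    have h1 := hwn =≫ f
    rw [Category.assoc, hs'] at h1
    have h2 : (w ≫ fst _ _ ≫ f) * (x' ≫ f) = x' ≫ f := by
      have h2 : w ≫ (H ◁ q) ≫ (H ◁ j) ≫ (f ⊗ₘ f) = lift (w ≫ fst _ _ ≫ f) (x' ≫ f) := by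
        refine CartesianMonoidalCategory.hom_ext _ _ (by simp) ?_
        simp only [Category.assoc, whiskerLeft_snd_assoc, tensorHom_snd, lift_snd,
          reassoc_of% hws, hx']
      rw [Hom.mul_def, ← h2]
      simpa only [m, Category.assoc] using h1
    exact mul_eq_right.mp h2
  obtain ⟨e, he, hew⟩ := hf.exists_toUnit_comp_eq hε₁ (w ≫ fst _ _)
    ((Category.assoc _ _ _).trans hwf)
  have hw : lift (toUnit _ ≫ e) (𝟙 _) = w := by
    ext1
    · rw [lift_fst, hew]
    · rw [lift_snd, hws]
  obtain ⟨s, hs, hsf⟩ := exists_whiskerLeft_comp_eq f q s' ((H ◁ j) ≫ m) hs' e j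
    (by rw [hw, hwn])
  have : UniversallyOpen (snd H H).left :=
    MorphismProperty.of_isPullback (isPullback_snd_left H H)
      (inferInstanceAs (UniversallyOpen H.hom))
  have := smooth_tensorObj_hom H H
  obtain ⟨n, hn, hns⟩ := exists_lift_of_generic_over f m (snd H H) (snd H H).left.isOpenMap
    (fun P g _ a ↦ Smooth.exists_eventually_specializes (g ≫ (H ⊗ H).hom) a) hy
    (isPullback_whiskerLeft_left j) s hsf
  have hn'eq : translation n x' = n' := by
    ext1
    · rw [translation_fst, hx', whiskerLeft_comp, Category.assoc, hns, hs]
    · rw [translation_snd, hsnd]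
  have : IsIso (translation n x') := hn'eq ▸ hiso
  refine ⟨n, ?_, hn'eq⟩
  refine mem_groupStructures f n hn e he x' (Nonempty.some inferInstance) ?_ ?_
  · rwa [Over.comp_left, Scheme.Hom.comp_apply, residuePointMap_left_apply]
  · have h1 : lift (toUnit _ ≫ e) x' ≫ n = lift (toUnit _ ≫ e) (𝟙 _) ≫ (H ◁ x') ≫ n := by
      rw [lift_whiskerLeft_assoc, Category.id_comp]
    rw [h1, ← translation_fst, hn'eq, hw]
    exact hwn

end EtaleIsogeny

/-! ### The bijection -/

open EtaleIsogeny

theorem proposition2p11 {k : Type u} [Field k]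
    (G H : Over (Spec (CommRingCat.of k))) [GrpObj G]
    (hG : Smooth G.hom) (hGc : GeometricallyConnected G.hom)
    (hHc : GeometricallyConnected H.hom)
    {A : Type v} [Group A] [Finite A]
    (f : H ⟶ G) (ρ : A →* Aut (Over.mk f.left)) (hf : EtaleIsogeny.IsTorsor f.left ρ)
    (hN : Nonempty (𝟙_ (Over (Spec (CommRingCat.of k))) ⟶ pullback f η[G]))
    (x : G.left) (hx : IsGenericPoint x Set.univ)
    (y : H.left) (hy : IsGenericPoint y Set.univ)
    (L' : Type u) [Field L'] [Algebra (H.left.residueField y) L'] :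
    Set.BijOn
      (fun ν : H ⊗ H ⟶ H => EtaleIsogeny.translation ν
        (EtaleIsogeny.extensionPointMap H y L' ≫ EtaleIsogeny.residuePointMap H y))
      (EtaleIsogeny.groupStructures f)
      (EtaleIsogeny.translationLifts f (EtaleIsogeny.residuePointMap G x)
        (EtaleIsogeny.extensionPointMap H y L' ≫ EtaleIsogeny.residuePointHom f
          (EtaleIsogeny.map_genericPoint f.left hf.surjective hy hx))) := by
  have := hf.finite
  have := hf.etale
  have : ConnectedSpace (Spec (CommRingCat.of k)) := inferInstance
  have : Smooth H.hom := by rw [← Over.w f]; infer_instance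
  have : ConnectedSpace H.left := GeometricallyConnected.connectedSpace H.hom H.hom.isOpenMap
  have := connectedSpace_tensorObj_left H H
  have : ConnectedSpace (extensionPoint H y L').left :=
    inferInstanceAs (ConnectedSpace (Spec (CommRingCat.of L')))
  have : Subsingleton (extensionPoint H y L').left :=
    inferInstanceAs (Subsingleton (Spec (CommRingCat.of L')))
  have := connectedSpace_tensorObj_left H (extensionPoint H y L')
  set h := EtaleIsogeny.map_genericPoint f.left hf.surjective hy hx
  have hξ : residuePointHom f h ≫ residuePointMap G x = residuePointMap H y ≫ f :=
    residuePointHom_comp_residuePointMap f h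
  set j := residuePointMap H y
  set q := extensionPointMap H y L'
  set x' := q ≫ j with hx'
  have hq : (q ≫ residuePointHom f h) ≫ residuePointMap G x = x' ≫ f := by
    rw [Category.assoc, hξ, hx', Category.assoc]
  refine ⟨?_, ?_, ?_⟩
  · rintro n ⟨g, rfl, hmon⟩
    exact ⟨isIso_translation x', translation_snd _ _,
      translation_comp_tensorHom hmon.mul_hom hq⟩
  · rintro n₁ ⟨g₁, rfl, hmon₁⟩ n₂ ⟨g₂, rfl, hmon₂⟩ heq
    -- Rigidity on the connected `H × H`, tested on `H × Spec L'`.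
    refine eq_of_comp_eq_over f (hmon₁.mul_hom.trans hmon₂.mul_hom.symm) (H ◁ x') ?_
    have := heq =≫ fst _ _
    simpa only [translation_fst] using this
  · rintro n' ⟨hiso, hsnd, hn'⟩
    obtain ⟨ε⟩ := hN
    have hε : (ε ≫ pullback.fst f η[G]) ≫ f = η[G] := by
      rw [Category.assoc, pullback.condition, ← Category.assoc,
        toUnit_unique (ε ≫ pullback.snd f η[G]) (𝟙 _), Category.id_comp]
    have h1 : (f ⊗ₘ q ≫ residuePointHom f h) ≫ (G ◁ residuePointMap G x) =
        (H ◁ x') ≫ (f ⊗ₘ f) := by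
      refine CartesianMonoidalCategory.hom_ext _ _ (by simp) ?_
      rw [Category.assoc, Category.assoc, whiskerLeft_snd, tensorHom_snd_assoc, tensorHom_snd,
        whiskerLeft_snd_assoc, hq]
    have h2 := hn' =≫ fst _ _
    rw [Category.assoc, tensorHom_fst, Category.assoc, translation_fst, reassoc_of% h1] at h2
    have : Flat q.left := inferInstanceAs (Flat (Spec.map (CommRingCat.ofHom
      (algebraMap (H.left.residueField y) L'))))
    have : Surjective q.left := inferInstanceAs (Surjective (Spec.map (CommRingCat.ofHom
      (algebraMap (H.left.residueField y) L'))))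
    have : QuasiCompact q.left := inferInstanceAs (QuasiCompact (Spec.map (CommRingCat.ofHom
      (algebraMap (H.left.residueField y) L'))))
    exact exists_mem_groupStructures f ρ hf _ hε hy q n' hiso hsnd h2
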